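/- Let $H$ be a separable infinite-dimensional complex Hilbert space and let $K(H)^+$ be the set of positive compact operators on $H$, with the operator norm and the usual order. For $a\in K(H)^+$ let $\lambda_1(a)\ge\lambda_2(a)\ge\cdots$ be its eigenvalue sequence: the positive eigenvalues of $a$ in decreasing order, counted with multiplicity, continued by zeros if $a$ has finite rank. For an increasing function $\alpha:\{0,1,2,\dots\}\to[0,\infty)$ with $\alpha(0)=0$, put $$\varphi_\alpha(a)=\sum_{i=1}^{\infty}\bigl(\lambda_i(a)-\lambda_{i+1}(a)\bigr)\,\alpha(i)\in[0,\infty]\qquad(a\in K(H)^+).$$ Write $\sigma(a)$ for the spectrum of $a$, $C(\sigma(a))^+$ for the set of non-negative continuous functions on $\sigma(a)$, and $f(a)$ for the continuous functional calculus. Functions $f,g$ on $\sigma(a)$ are comonotonic if $(f(s)-f(t))(g(s)-g(t))\ge 0$ for all $s,t\in\sigma(a)$. Let $\varphi:K(H)^+\to[0,\infty]$ be an arbitrary map. Then the following conditions are equivalent: (1) $\varphi=\varphi_\alpha$ for some increasing function $\alpha:\{0,1,2,\dots\}\to[0,\infty)$ with $\alpha(0)=0$. (2) $\varphi(f(a)+g(a))=\varphi(f(a))+\varphi(g(a))$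 for every $a\in K(H)^+$ and all increasing $f,g\in C(\sigma(a))^+$ with $f(0)=g(0)=0$; $\varphi$ is unitarily invariant ($\varphi(uau^*)=\varphi(a)$ for every $a\in K(H)^+$ and every unitary $u$ on $H$), monotone ($a\le b$ implies $\varphi(a)\le\varphi(b)$), positively homogeneous ($\varphi(ka)=k\varphi(a)$ for every $a\in K(H)^+$ and every real $k\ge0$, where $0\cdot\infty=0$) and lower semicontinuous on $K(H)^+$ with respect to the operator norm; and $\varphi(a)<\infty$ for every finite-rank $a\in K(H)^+$. (3) $\varphi(f(a)+g(a))=\varphi(f(a))+\varphi(g(a))$ for every $a\in K(H)^+$ and all comonotonic $f,g\in C(\sigma(a))^+$ with $f(0)=g(0)=0$; $\varphi$ is unitarily invariant, monotone, positively homogeneous and lower semicontinuous on $K(H)^+$ with respect to the operator norm; and $\varphi(a)<\infty$ for every finite-rank $a\in K(H)^+$. -/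

import Mathlib

open scoped NNReal ENNReal

noncomputable section

namespace ChoquetTrace

variable {H : Type*} [NormedAddCommGroup H] [InnerProductSpace ℂ H] [CompleteSpace H]

/-- The cone `K(H)^+` of positive compact operators on `H`, with the Loewner order and the
operator-norm topology inherited from `B(H)`. -/
def posCompact (H : Type*) [NormedAddCommGroup H] [InnerProductSpace ℂ H] [CompleteSpace H] :
    Submodule ℝ≥0 (H →L[ℂ] H) where
  carrier := {a | 0 ≤ a ∧ IsCompactOperator a}
  add_mem' := fun ha hb => ⟨add_nonneg ha.1 hb.1, ha.2.add hb.2⟩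
  zero_mem' := ⟨le_rfl, isCompactOperator_zero⟩
  smul_mem' := fun k _ ha => ⟨smul_nonneg k.2 ha.1, ha.2.smul k⟩

instance : Module ℝ≥0 (posCompact H) := (posCompact H).module

instance : SMul ℝ≥0 (posCompact H) := (posCompact H).module.toSMul

/-- `u a u*` for `a ∈ K(H)^+` and a unitary `u ∈ B(H)`. -/
def unitaryConj (u : unitary (H →L[ℂ] H)) (a : posCompact H) : posCompact H :=
  ⟨(u : H →L[ℂ] H) * (a : H →L[ℂ] H) * star (u : H →L[ℂ] H),
    star_right_conjugate_nonneg a.2.1 _,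
    (a.2.2.clm_comp (u : H →L[ℂ] H)).comp_clm (star (u : H →L[ℂ] H))⟩

/-- `f` represents an element of `C(σ(a))^+` that vanishes at `0`: it is continuous and
non-negative on the spectrum of `a` and `f 0 = 0`. Its values off `σ(a) ∪ {0}` are irrelevant. -/
structure IsPosVanishing (a : H →L[ℂ] H) (f : ℝ → ℝ) : Prop where
  continuousOn : ContinuousOn f (spectrum ℝ a)
  nonneg : ∀ x ∈ spectrum ℝ a, 0 ≤ f x
  map_zero : f 0 = 0

theorem isCompactOperator_cfc {a : H →L[ℂ] H} (ha : 0 ≤ a) (hc : IsCompactOperator a)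
    {f : ℝ → ℝ} (hf : IsPosVanishing a f) : IsCompactOperator (cfc f a : H →L[ℂ] H) := by
  have hsa : IsSelfAdjoint a := ha.isSelfAdjoint
  have hcont : ContinuousOn f (quasispectrum ℝ a) := by
    rw [quasispectrum_eq_spectrum_union_zero]
    exact hf.continuousOn.union_of_isClosed (continuousOn_singleton f 0)
      (spectrum.isClosed a) isClosed_singleton
  have hmem : cfc f a ∈ NonUnitalStarAlgebra.elemental ℝ a := by
    rw [← cfcₙ_eq_cfc hcont hf.map_zero]
    exact cfcₙ_mem_elemental f a
  have hadj : ∀ x ∈ NonUnitalStarAlgebra.adjoin ℝ ({a} : Set (H →L[ℂ] H)),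
      IsCompactOperator x ∧ IsCompactOperator (star x : H →L[ℂ] H) := by
    intro x hx
    induction hx using NonUnitalStarAlgebra.adjoin_induction with
    | mem x hx =>
      rw [Set.mem_singleton_iff] at hx
      subst hx
      exact ⟨hc, by rwa [hsa.star_eq]⟩
    | add x y _ _ hx hy =>
      exact ⟨hx.1.add hy.1, by rw [star_add]; exact hx.2.add hy.2⟩
    | zero => exact ⟨isCompactOperator_zero, by rw [star_zero]; exact isCompactOperator_zero⟩
    | mul x y _ _ hx hy =>
      exact ⟨hx.1.comp_clm y, by rw [star_mul]; exact hy.2.comp_clm (star x)⟩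
    | smul r x _ hx =>
      exact ⟨hx.1.smul r, by rw [star_smul]; exact hx.2.smul (star r)⟩
    | star x _ hx => exact ⟨hx.2, by rw [star_star]; exact hx.1⟩
  have hclosed : IsClosed {x : H →L[ℂ] H | IsCompactOperator x} :=
    isClosed_setOfPred_isCompactOperator
  exact closure_minimal (fun x hx => (hadj x hx).1) hclosed hmem

/-- The continuous functional calculus `f(a) ∈ K(H)^+` of `a ∈ K(H)^+`. -/
def funCalc (a : posCompact H) (f : ℝ → ℝ) (hf : IsPosVanishing (a : H →L[ℂ] H) f) :
    posCompact H :=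
  ⟨cfc f (a : H →L[ℂ] H), cfc_nonneg hf.nonneg, isCompactOperator_cfc a.2.1 a.2.2 hf⟩

/-- The eigenvalue sequence of `a`, indexed from `0`: `eigenvalueSeq a n` is `λ_{n+1}(a)`, the
`(n+1)`-st entry in the decreasing list of the positive eigenvalues of `a`, each repeated as often
as the dimension of its eigenspace, the list being continued by zeros if it is finite.
It is the least `t ≥ 0` such that at most `n` eigenvalues, counted with multiplicity, exceed `t`. -/
def eigenvalueSeq (a : H →L[ℂ] H) (n : ℕ) : ℝ :=
  sInf {t : ℝ | 0 ≤ t ∧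
    Module.rank ℂ ↥(⨆ μ ∈ Set.Ioi t, Module.End.eigenspace (a : H →ₗ[ℂ] H) ((μ : ℝ) : ℂ))
      ≤ (n : Cardinal)}

/-- `φ_α(a) = ∑_{i ≥ 1} (λ_i(a) - λ_{i+1}(a)) α(i)`, with the sum shifted to start at `0`. -/
def choquetTrace (α : ℕ → ℝ≥0) (a : posCompact H) : ℝ≥0∞ :=
  ∑' i : ℕ, ENNReal.ofReal (eigenvalueSeq (a : H →L[ℂ] H) i
    - eigenvalueSeq (a : H →L[ℂ] H) (i + 1)) * (α (i + 1) : ℝ≥0∞)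

/-- `f` and `g` are comonotonic on `s`. -/
def ComonotonicOn (f g : ℝ → ℝ) (s : Set ℝ) : Prop :=
  ∀ x ∈ s, ∀ y ∈ s, 0 ≤ (f x - f y) * (g x - g y)

def IsUnitarilyInvariant (φ : posCompact H → ℝ≥0∞) : Prop :=
  ∀ (u : unitary (H →L[ℂ] H)) (a : posCompact H), φ (unitaryConj u a) = φ a

/-- In `ℝ≥0∞` one has `0 * ∞ = 0`. -/
def IsPosHomogeneous (φ : posCompact H → ℝ≥0∞) : Prop :=
  ∀ (k : ℝ≥0) (a : posCompact H), φ (k • a : posCompact H) = (k : ℝ≥0∞) * φ a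

def IsMonotoneIncreasingAdditive (φ : posCompact H → ℝ≥0∞) : Prop :=
  ∀ (a : posCompact H) (f g : ℝ → ℝ)
    (hf : IsPosVanishing (a : H →L[ℂ] H) f) (hg : IsPosVanishing (a : H →L[ℂ] H) g),
    MonotoneOn f (spectrum ℝ (a : H →L[ℂ] H)) → MonotoneOn g (spectrum ℝ (a : H →L[ℂ] H)) →
      φ (funCalc a f hf + funCalc a g hg) = φ (funCalc a f hf) + φ (funCalc a g hg)

def IsComonotonicAdditive (φ : posCompact H → ℝ≥0∞) : Prop :=
  ∀ (a : posCompact H) (f g : ℝ → ℝ)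
    (hf : IsPosVanishing (a : H →L[ℂ] H) f) (hg : IsPosVanishing (a : H →L[ℂ] H) g),
    ComonotonicOn f g (spectrum ℝ (a : H →L[ℂ] H)) →
      φ (funCalc a f hf + funCalc a g hg) = φ (funCalc a f hf) + φ (funCalc a g hg)

def IsFiniteOnFiniteRank (φ : posCompact H → ℝ≥0∞) : Prop :=
  ∀ a : posCompact H,
    FiniteDimensional ℂ (LinearMap.range ((a : H →L[ℂ] H) : H →ₗ[ℂ] H)) → φ a < ∞

end ChoquetTrace

end

/-!
The superlevel sets `{f > t}` and `{g > s}` of comonotonic functions `f`, `g` are nested, so the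
eigenvalues of `f(a)` and `g(a)` add up: `λ_i(f(a) + g(a)) = λ_i(f(a)) + λ_i(g(a))`. After a
summation by parts `φ_α` is a non-negative combination of the `λ_i`, which gives its comonotonic
additivity, and the min-max principle gives its monotonicity and lower semicontinuity.

Conversely, a functional that is additive on increasing functions of `a` is determined by its
values on finite-rank projections: the truncation `(a - t)^+` is a finite non-negative combination
of spectral projections of `a`, obtained by repeatedly splitting off a multiple of the projection
onto the support, and lower semicontinuity passes to the limit `t → 0`. By unitary invariance the
value on a projection depends on its rank `n` only; call it `α n`.
-/

noncomputable section

namespace ChoquetTrace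

section SpectralSubspace

variable {E : Type*} [NormedAddCommGroup E] [NormedSpace ℂ E] {a b : E →L[ℂ] E}

/-- The algebraic span of the eigenspaces of `a` for its real eigenvalues in `S`. For a compact
self-adjoint operator its closure is the range of the spectral projection of `S`. -/
def spectralSubspace (a : E →L[ℂ] E) (S : Set ℝ) : Submodule ℂ E :=
  ⨆ μ ∈ S, Module.End.eigenspace (a : E →ₗ[ℂ] E) ((μ : ℝ) : ℂ)

theorem mem_spectralSubspace {S : Set ℝ} {μ : ℝ} (hμ : μ ∈ S) {x : E}
    (hx : a x = (μ : ℂ) • x) : x ∈ spectralSubspace a S :=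
  Submodule.mem_iSup_of_mem μ <| Submodule.mem_iSup_of_mem hμ <| Module.End.mem_eigenspace_iff.2 hx

theorem spectralSubspace_le {S : Set ℝ} {W : Submodule ℂ E}
    (h : ∀ μ ∈ S, ∀ x, a x = (μ : ℂ) • x → x ∈ W) : spectralSubspace a S ≤ W :=
  iSup₂_le fun μ hμ x hx => h μ hμ x (Module.End.mem_eigenspace_iff.1 hx)

theorem mem_spectrum_of_apply_eq_smul {μ : ℝ} {x : E} (hx : x ≠ 0) (h : a x = (μ : ℂ) • x) :
    μ ∈ spectrum ℝ a := by
  rw [spectrum.mem_iff]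
  refine fun hu => hx ?_
  have hker : (algebraMap ℝ (E →L[ℂ] E) μ - a) x = 0 := by
    simp [h, Algebra.algebraMap_eq_smul_one]
  calc x = ((↑hu.unit⁻¹ : E →L[ℂ] E) * ↑hu.unit) x := by rw [hu.unit.inv_mul, one_apply_eq_self]
    _ = 0 := by rw [mul_apply_eq_comp, hu.unit_spec, hker, map_zero]

theorem spectralSubspace_mono {S S' : Set ℝ} (h : spectrum ℝ a ∩ S ⊆ S') :
    spectralSubspace a S ≤ spectralSubspace a S' := by
  refine spectralSubspace_le fun μ hμ x hx => ?_
  rcases eq_or_ne x 0 with rfl | h0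
  · exact zero_mem _
  · exact mem_spectralSubspace (h ⟨mem_spectrum_of_apply_eq_smul h0 hx, hμ⟩) hx

theorem spectralSubspace_Ioi_antitone : Antitone fun t => spectralSubspace a (Set.Ioi t) :=
  fun _ _ hst => spectralSubspace_mono
    (Set.inter_subset_right.trans (Set.Ioi_subset_Ioi hst))

theorem spectralSubspace_Ioi_norm (a : E →L[ℂ] E) : spectralSubspace a (Set.Ioi ‖a‖) = ⊥ := by
  refine eq_bot_iff.2 (spectralSubspace_le fun μ hμ x hx => ?_)
  have hnorm : μ * ‖x‖ ≤ ‖a‖ * ‖x‖ := calc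
    μ * ‖x‖ ≤ |μ| * ‖x‖ := by gcongr; exact le_abs_self μ
    _ = ‖a x‖ := by rw [hx, norm_smul, Complex.norm_real, Real.norm_eq_abs]
    _ ≤ ‖a‖ * ‖x‖ := a.le_opNorm x
  by_contra h0
  exact (le_of_mul_le_mul_right hnorm (norm_pos_iff.2 h0)).not_gt hμ

theorem spectralSubspace_Ioi_le_range (a : E →L[ℂ] E) {t : ℝ} (ht : 0 ≤ t) :
    spectralSubspace a (Set.Ioi t) ≤ LinearMap.range (a : E →ₗ[ℂ] E) := by
  refine spectralSubspace_le fun μ hμ x hx => ⟨(μ : ℂ)⁻¹ • x, ?_⟩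
  have hμ0 : (μ : ℂ) ≠ 0 := Complex.ofReal_ne_zero.2 (ht.trans_lt hμ).ne'
  rw [map_smul, ContinuousLinearMap.coe_coe, hx, inv_smul_smul₀ hμ0]

theorem spectralSubspace_Ioi_eq_iSup (a : E →L[ℂ] E) (t : ℝ) :
    spectralSubspace a (Set.Ioi t) = ⨆ s : Set.Ioi t, spectralSubspace a (Set.Ioi s) := by
  refine le_antisymm (spectralSubspace_le fun μ hμ x hx => ?_)
    (iSup_le fun s => spectralSubspace_Ioi_antitone s.2.le)
  obtain ⟨s, hts, hsμ⟩ := exists_between (Set.mem_Ioi.1 hμ)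
  exact Submodule.mem_iSup_of_mem (⟨s, hts⟩ : Set.Ioi t) (mem_spectralSubspace hsμ hx)

theorem exists_gt_le_rank_spectralSubspace_Ioi {t : ℝ} {m : ℕ}
    (h : (m : Cardinal) ≤ Module.rank ℂ (spectralSubspace a (Set.Ioi t))) :
    ∃ s > t, (m : Cardinal) ≤ Module.rank ℂ (spectralSubspace a (Set.Ioi s)) := by
  obtain ⟨v, hv⟩ := Module.le_rank_iff.1 h
  have hdir : Directed (· ≤ ·) fun s : Set.Ioi t => spectralSubspace a (Set.Ioi (s : ℝ)) :=
    (spectralSubspace_Ioi_antitone.comp_monotone (Subtype.mono_coe _)).directed_le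
  have hmem (i : Fin m) : ∃ s : Set.Ioi t, (v i : E) ∈ spectralSubspace a (Set.Ioi s) := by
    rw [← Submodule.mem_iSup_of_directed _ hdir, ← spectralSubspace_Ioi_eq_iSup]
    exact (v i).2
  choose s hs using hmem
  obtain ⟨r, hr⟩ := hdir.finite_le s
  refine ⟨r, r.2, Module.le_rank_iff.2 ⟨fun i => ⟨v i, hr i (hs i)⟩, ?_⟩⟩
  have hvE : LinearIndependent ℂ fun i => (v i : E) := hv.map' _ (Submodule.ker_subtype _)
  exact LinearIndependent.of_comp (Submodule.subtype _) hvE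

theorem spectralSubspace_smul {k : ℝ} (hk : k ≠ 0) (a : E →L[ℂ] E) (S : Set ℝ) :
    spectralSubspace (k • a) S = spectralSubspace a {μ | k * μ ∈ S} := by
  have hkℂ : (k : ℂ) ≠ 0 := Complex.ofReal_ne_zero.2 hk
  have happly (x : E) : (k • a) x = (k : ℂ) • a x := (Complex.coe_smul k (a x)).symm
  refine le_antisymm (spectralSubspace_le fun μ hμ x hx => ?_)
    (spectralSubspace_le fun μ hμ x hx => mem_spectralSubspace (μ := k * μ) hμ ?_)
  · have hS : k⁻¹ * μ ∈ {μ | k * μ ∈ S} := by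
      rwa [Set.mem_ofPred_eq, mul_inv_cancel_left₀ hk]
    refine mem_spectralSubspace hS ?_
    rw [happly] at hx
    rw [Complex.ofReal_mul, mul_smul, ← hx, Complex.ofReal_inv, inv_smul_smul₀ hkℂ]
  · rw [happly, hx, Complex.ofReal_mul, mul_smul]

theorem map_spectralSubspace (e : E ≃ₗ[ℂ] E) (h : ∀ x, b (e x) = e (a x)) (S : Set ℝ) :
    (spectralSubspace a S).map (e : E →ₗ[ℂ] E) = spectralSubspace b S := by
  refine le_antisymm (Submodule.map_le_iff_le_comap.2 <| spectralSubspace_le fun μ hμ x hx =>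
    mem_spectralSubspace hμ ?_) (spectralSubspace_le fun μ hμ x hx =>
      ⟨e.symm x, mem_spectralSubspace hμ (e.injective ?_), e.apply_symm_apply x⟩)
  · rw [LinearEquiv.coe_coe, h, hx, map_smul]
  · rw [← h, e.apply_symm_apply, hx, map_smul, e.apply_symm_apply]

theorem spectralSubspace_union (a : E →L[ℂ] E) (S S' : Set ℝ) :
    spectralSubspace a (S ∪ S') = spectralSubspace a S ⊔ spectralSubspace a S' :=
  iSup_union

/-- `T` multiplies the eigenvectors of `a` for a real eigenvalue `μ` by `g μ`. This is what is
needed of the relation `T = g(a)`, and it also covers `T = a` with `g = id`. -/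
def ActsOnEigenvectors (a T : E →L[ℂ] E) (g : ℝ → ℝ) : Prop :=
  ∀ ⦃μ : ℝ⦄ ⦃x : E⦄, a x = (μ : ℂ) • x → T x = (g μ : ℂ) • x

theorem actsOnEigenvectors_id (a : E →L[ℂ] E) : ActsOnEigenvectors a a id :=
  fun _ _ hx => hx

theorem ActsOnEigenvectors.spectralSubspace_preimage_le {T : E →L[ℂ] E} {g : ℝ → ℝ}
    (hT : ActsOnEigenvectors a T g) (S : Set ℝ) :
    spectralSubspace a (g ⁻¹' S) ≤ spectralSubspace T S :=
  spectralSubspace_le fun _ hμ _ hx => mem_spectralSubspace (Set.mem_preimage.1 hμ) (hT hx)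

end SpectralSubspace

section QuadraticForm

theorem finiteDimensional_of_isClosedEmbedding_of_isCompactOperator {𝕜 E F : Type*}
    [NontriviallyNormedField 𝕜] [ProperSpace 𝕜] [NormedAddCommGroup E] [NormedSpace 𝕜 E]
    [NormedAddCommGroup F] [NormedSpace 𝕜 F] {T : E →L[𝕜] F} (hT : Topology.IsClosedEmbedding T)
    (hc : IsCompactOperator T) : FiniteDimensional 𝕜 E :=
  let ⟨K, hK, hK0⟩ := hc
  isCompactOperator_id_iff_finiteDimensional.1 ⟨T ⁻¹' K, hT.isCompact_preimage hK, hK0⟩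

theorem rank_le_rank_of_disjoint_orthogonal {𝕜 E : Type*} [RCLike 𝕜] [NormedAddCommGroup E]
    [InnerProductSpace 𝕜 E] {V W : Submodule 𝕜 E} [W.HasOrthogonalProjection]
    (h : Disjoint V Wᗮ) : Module.rank 𝕜 V ≤ Module.rank 𝕜 W := by
  refine LinearMap.rank_le_of_injective ((W.orthogonalProjectionOnto : E →ₗ[𝕜] W).domRestrict V) ?_
  refine (injective_iff_map_eq_zero _).2 fun x hx => Subtype.ext ?_
  exact Submodule.disjoint_def.1 h x x.2 (Submodule.orthogonalProjectionOnto_eq_zero_iff.1 hx)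

variable {H : Type*} [NormedAddCommGroup H] [InnerProductSpace ℂ H] {a T : H →L[ℂ] H} {g : ℝ → ℝ}

theorem isOrtho_spectralSubspace (ha : (a : H →ₗ[ℂ] H).IsSymmetric) {S S' : Set ℝ}
    (h : Disjoint S S') : spectralSubspace a S ⟂ spectralSubspace a S' := by
  simp only [spectralSubspace, Submodule.isOrtho_iSup_left, Submodule.isOrtho_iSup_right]
  refine fun ν hν μ hμ => ha.orthogonalFamily_eigenspaces.isOrtho fun hμν => ?_
  exact h.ne_of_mem hμ hν (Complex.ofReal_injective hμν)

theorem exists_eigenvector_sum_of_mem_spectralSubspace (ha : (a : H →ₗ[ℂ] H).IsSymmetric)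
    (hT : ActsOnEigenvectors a T g) {S : Set ℝ} {y : H} (hy : y ∈ spectralSubspace a S) :
    ∃ (s : Finset S) (w : S → H), y = ∑ μ ∈ s, w μ ∧ ‖y‖ ^ 2 = ∑ μ ∈ s, ‖w μ‖ ^ 2 ∧
      T.reApplyInnerSelf y = ∑ μ ∈ s, g μ * ‖w μ‖ ^ 2 := by
  classical
  rw [spectralSubspace, iSup_subtype', Submodule.mem_iSup_iff_exists_finsupp] at hy
  obtain ⟨w, hw, rfl⟩ := hy
  let v (μ : S) : Module.End.eigenspace (a : H →ₗ[ℂ] H) ((μ : ℝ) : ℂ) := ⟨w μ, hw μ⟩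
  have horth := ha.orthogonalFamily_eigenspaces.comp
    (f := fun μ : S => ((μ : ℝ) : ℂ)) (Complex.ofReal_injective.comp Subtype.val_injective)
  have hTw : T (w.sum fun _ x => x) = ∑ μ ∈ w.support, (g μ : ℂ) • w μ := by
    rw [Finsupp.sum, map_sum]
    exact Finset.sum_congr rfl fun μ _ => hT (Module.End.mem_eigenspace_iff.1 (hw μ))
  have hinner := horth.inner_sum (fun μ => (g μ : ℂ) • v μ) v w.support
  refine ⟨w.support, w, rfl, horth.norm_sum v w.support, ?_⟩
  simp only [v, Submodule.coe_inner, SetLike.val_smul, Submodule.coe_subtypeₗᵢ,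
    Submodule.coe_subtype] at hinner
  rw [ContinuousLinearMap.reApplyInnerSelf_apply, hTw, Finsupp.sum, hinner, map_sum]
  refine Finset.sum_congr rfl fun μ _ => ?_
  rw [inner_smul_left, inner_self_eq_norm_sq_to_K]
  simp [← Complex.ofReal_pow]

theorem reApplyInnerSelf_le_of_mem_spectralSubspace (ha : (a : H →ₗ[ℂ] H).IsSymmetric)
    (hT : ActsOnEigenvectors a T g) {S : Set ℝ} {t : ℝ} (hg : ∀ μ ∈ S, g μ ≤ t) {y : H}
    (hy : y ∈ spectralSubspace a S) : T.reApplyInnerSelf y ≤ t * ‖y‖ ^ 2 := by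
  obtain ⟨s, w, -, hnorm, hform⟩ := exists_eigenvector_sum_of_mem_spectralSubspace ha hT hy
  rw [hnorm, hform, Finset.mul_sum]
  exact Finset.sum_le_sum fun μ _ => mul_le_mul_of_nonneg_right (hg μ μ.2) (sq_nonneg _)

theorem lt_reApplyInnerSelf_of_mem_spectralSubspace (ha : (a : H →ₗ[ℂ] H).IsSymmetric)
    (hT : ActsOnEigenvectors a T g) {S : Set ℝ} {t : ℝ} (hg : ∀ μ ∈ S, t < g μ) {y : H}
    (hy : y ∈ spectralSubspace a S) (h0 : y ≠ 0) : t * ‖y‖ ^ 2 < T.reApplyInnerSelf y := by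
  obtain ⟨s, w, hsum, hnorm, hform⟩ := exists_eigenvector_sum_of_mem_spectralSubspace ha hT hy
  obtain ⟨μ, hμ, hne⟩ : ∃ μ ∈ s, w μ ≠ 0 := by
    by_contra! hw
    exact h0 (hsum.trans (Finset.sum_eq_zero hw))
  rw [hnorm, hform, Finset.mul_sum]
  exact Finset.sum_lt_sum
    (fun ν _ => mul_le_mul_of_nonneg_right (hg ν ν.2).le (sq_nonneg _))
    ⟨μ, hμ, mul_lt_mul_of_pos_right (hg μ μ.2) (by positivity)⟩

theorem mul_norm_le_of_mem_closure_spectralSubspace (ha : (a : H →ₗ[ℂ] H).IsSymmetric) {t : ℝ}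
    {x : H} (hx : x ∈ (spectralSubspace a (Set.Ioi t)).topologicalClosure) :
    t * ‖x‖ ≤ ‖a x‖ := by
  have hcl : IsClosed {y : H | t * ‖y‖ ≤ ‖a y‖} := isClosed_le (by fun_prop) (by fun_prop)
  refine closure_minimal (fun y hy => ?_) hcl hx
  rcases eq_or_ne y 0 with rfl | h0
  · simp
  have hlt := lt_reApplyInnerSelf_of_mem_spectralSubspace ha (actsOnEigenvectors_id a)
    (fun _ hμ => hμ) hy h0
  have hle : a.reApplyInnerSelf y ≤ ‖a y‖ * ‖y‖ := re_inner_le_norm _ _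
  refine le_of_mul_le_mul_right ?_ (norm_pos_iff.2 h0)
  linarith

variable [CompleteSpace H]

theorem orthogonal_spectralSubspace_univ (ha : (a : H →ₗ[ℂ] H).IsSymmetric)
    (hc : IsCompactOperator a) : (spectralSubspace a Set.univ)ᗮ = ⊥ := by
  rw [eq_bot_iff, ← ContinuousLinearMap.orthogonalComplement_iSup_eigenspaces_eq_bot hc ha]
  refine Submodule.orthogonal_le (iSup_le fun μ x hx => ?_)
  rcases eq_or_ne x 0 with rfl | h0
  · exact zero_mem _
  have hreal : ((μ.re : ℝ) : ℂ) = μ := Complex.conj_eq_iff_re.1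
    (ha.conj_eigenvalue_eq_self (Module.End.hasEigenvalue_of_hasEigenvector ⟨hx, h0⟩))
  refine mem_spectralSubspace (μ := μ.re) (Set.mem_univ _) ?_
  rw [hreal]
  exact Module.End.mem_eigenspace_iff.1 hx

theorem orthogonal_spectralSubspace (ha : (a : H →ₗ[ℂ] H).IsSymmetric)
    (hc : IsCompactOperator a) (S : Set ℝ) :
    (spectralSubspace a S)ᗮ = (spectralSubspace a Sᶜ).topologicalClosure := by
  set K := (spectralSubspace a Sᶜ).topologicalClosure
  have : CompleteSpace K := (Submodule.isClosed_topologicalClosure _).completeSpace_coe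
  have hK : K ≤ (spectralSubspace a S)ᗮ := Submodule.topologicalClosure_minimal _
    (isOrtho_spectralSubspace ha disjoint_compl_left) (Submodule.isClosed_orthogonal _)
  have hbot : Kᗮ ⊓ (spectralSubspace a S)ᗮ = ⊥ := by
    rw [Submodule.orthogonal_closure, Submodule.inf_orthogonal, ← spectralSubspace_union,
      Set.compl_union_self, orthogonal_spectralSubspace_univ ha hc]
  have hsup := Submodule.sup_orthogonal_inf_of_hasOrthogonalProjection hK
  rwa [hbot, sup_bot_eq, eq_comm] at hsup

theorem reApplyInnerSelf_le_of_mem_orthogonal_spectralSubspace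
    (ha : (a : H →ₗ[ℂ] H).IsSymmetric) (hc : IsCompactOperator a) (hT : ActsOnEigenvectors a T g)
    {t : ℝ} {x : H} (hx : x ∈ (spectralSubspace a {μ | t < g μ})ᗮ) :
    T.reApplyInnerSelf x ≤ t * ‖x‖ ^ 2 := by
  rw [orthogonal_spectralSubspace ha hc] at hx
  have hcl : IsClosed {y : H | T.reApplyInnerSelf y ≤ t * ‖y‖ ^ 2} :=
    isClosed_le T.reApplyInnerSelf_continuous (by fun_prop)
  exact closure_minimal (fun y hy => reApplyInnerSelf_le_of_mem_spectralSubspace ha hT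
    (fun μ hμ => not_lt.1 hμ) hy) hcl hx

/-- One half of the min-max principle. -/
theorem rank_le_of_lt_reApplyInnerSelf
    (ha : (a : H →ₗ[ℂ] H).IsSymmetric) (hc : IsCompactOperator a) (hT : ActsOnEigenvectors a T g)
    {t : ℝ} {V : Submodule ℂ H} (hV : ∀ x ∈ V, x ≠ 0 → t * ‖x‖ ^ 2 < T.reApplyInnerSelf x) {n : ℕ}
    (hn : Module.rank ℂ (spectralSubspace a {μ | t < g μ}) ≤ n) : Module.rank ℂ V ≤ n := by
  have : FiniteDimensional ℂ (spectralSubspace a {μ | t < g μ}) :=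
    Module.rank_lt_aleph0_iff.1 (hn.trans_lt Cardinal.natCast_lt_aleph0)
  refine (rank_le_rank_of_disjoint_orthogonal ?_).trans hn
  refine Submodule.disjoint_def.2 fun x hxV hx => by_contra fun h0 => ?_
  exact (reApplyInnerSelf_le_of_mem_orthogonal_spectralSubspace ha hc hT hx).not_gt (hV x hxV h0)

theorem ActsOnEigenvectors.rank_spectralSubspace_le_iff (hT : ActsOnEigenvectors a T g)
    (ha : (a : H →ₗ[ℂ] H).IsSymmetric) (hac : IsCompactOperator a)
    (hTs : (T : H →ₗ[ℂ] H).IsSymmetric) {t : ℝ} {n : ℕ} :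
    Module.rank ℂ (spectralSubspace T (Set.Ioi t)) ≤ n ↔
      Module.rank ℂ (spectralSubspace a {μ | t < g μ}) ≤ n :=
  ⟨(Submodule.rank_mono (hT.spectralSubspace_preimage_le (Set.Ioi t))).trans,
    rank_le_of_lt_reApplyInnerSelf ha hac hT fun _ hx =>
      lt_reApplyInnerSelf_of_mem_spectralSubspace hTs (actsOnEigenvectors_id T) (fun _ hμ => hμ) hx⟩

theorem rank_spectralSubspace_Ioi_add_le {b : H →L[ℂ] H} (ha : (a : H →ₗ[ℂ] H).IsSymmetric)
    (hb : (b : H →ₗ[ℂ] H).IsSymmetric) (hbc : IsCompactOperator b) {s t : ℝ}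
    (hab : ∀ x, a.reApplyInnerSelf x ≤ b.reApplyInnerSelf x + s * ‖x‖ ^ 2) {n : ℕ}
    (hn : Module.rank ℂ (spectralSubspace b (Set.Ioi t)) ≤ n) :
    Module.rank ℂ (spectralSubspace a (Set.Ioi (t + s))) ≤ n := by
  refine rank_le_of_lt_reApplyInnerSelf hb hbc (actsOnEigenvectors_id b) (fun x hx h0 => ?_) hn
  have := lt_reApplyInnerSelf_of_mem_spectralSubspace ha (actsOnEigenvectors_id a)
    (fun _ hμ => hμ) hx h0
  linarith [hab x]

theorem finiteDimensional_spectralSubspace (ha : (a : H →ₗ[ℂ] H).IsSymmetric)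
    (hc : IsCompactOperator a) {t : ℝ} (ht : 0 < t) :
    FiniteDimensional ℂ (spectralSubspace a (Set.Ioi t)) := by
  set V := (spectralSubspace a (Set.Ioi t)).topologicalClosure
  have : CompleteSpace V := (Submodule.isClosed_topologicalClosure _).completeSpace_coe
  have hanti : AntilipschitzWith (Real.toNNReal t⁻¹) (a.comp V.subtypeL) := by
    refine AddMonoidHomClass.antilipschitz_of_bound _ fun x => ?_
    rw [Real.coe_toNNReal _ (inv_nonneg.2 ht.le), le_inv_mul_iff₀ ht]
    exact mul_norm_le_of_mem_closure_spectralSubspace ha x.2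
  have : FiniteDimensional ℂ V := finiteDimensional_of_isClosedEmbedding_of_isCompactOperator
    (hanti.isClosedEmbedding (a.comp V.subtypeL).uniformContinuous) (hc.comp_clm V.subtypeL)
  exact Submodule.finiteDimensional_of_le (Submodule.le_topologicalClosure _)

theorem actsOnEigenvectors_cfc (ha : IsSelfAdjoint a) {f : ℝ → ℝ}
    (hf : ContinuousOn f (spectrum ℝ a)) : ActsOnEigenvectors a (cfc f a) f := by
  intro μ x hx
  rcases eq_or_ne x 0 with rfl | h0
  · simp
  have hμ := mem_spectrum_of_apply_eq_smul h0 hx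
  rw [cfc_apply f a ha hf]
  suffices ∀ F : C(spectrum ℝ a, ℝ), cfcHom ha F x = ((F ⟨μ, hμ⟩ : ℝ) : ℂ) • x from this _
  intro F
  open scoped ContinuousFunctionalCalculus in
  induction F using ContinuousMap.induction_on_of_compact with
  | const r =>
    have hconst : ContinuousMap.const (spectrum ℝ a) r = algebraMap ℝ _ r := rfl
    rw [hconst, AlgHomClass.commutes, Algebra.algebraMap_eq_smul_one]
    simp
  | id => rw [cfcHom_id ha, hx]; rfl
  | star_id => rw [star_trivial, cfcHom_id ha, hx]; rfl
  | add F G hF hG => rw [map_add]; simp [hF, hG, add_smul]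
  | mul F G hF hG =>
    rw [map_mul, mul_apply_eq_comp, hG, map_smul, hF, smul_smul]
    simp [mul_comm]
  | frequently F hF =>
    have hcl : IsClosed {G : C(spectrum ℝ a, ℝ) | cfcHom ha G x = ((G ⟨μ, hμ⟩ : ℝ) : ℂ) • x} :=
      isClosed_eq ((ContinuousLinearMap.apply ℂ H x).continuous.comp (cfcHom_continuous ha))
        ((Complex.continuous_ofReal.comp (continuous_eval_const _)).smul continuous_const)
    exact hcl.closure_subset (mem_closure_iff_frequently.2 hF)

end QuadraticForm

section EigenvalueSeq

variable {H : Type*} [NormedAddCommGroup H] [InnerProductSpace ℂ H] {a b : H →L[ℂ] H} {n : ℕ}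

theorem eigenvalueSeq_nonneg (a : H →L[ℂ] H) (n : ℕ) : 0 ≤ eigenvalueSeq a n :=
  Real.sInf_nonneg fun _ ht => ht.1

-- The infimum is attained: `n + 1` independent vectors of `spectralSubspace a (Ioi t)` already lie
-- in `spectralSubspace a (Ioi s)` for some `s > t`.
theorem eigenvalueSeq_le_iff {t : ℝ} : eigenvalueSeq a n ≤ t ↔
    0 ≤ t ∧ Module.rank ℂ (spectralSubspace a (Set.Ioi t)) ≤ n := by
  have hne : {t : ℝ | 0 ≤ t ∧ Module.rank ℂ (spectralSubspace a (Set.Ioi t)) ≤ n}.Nonempty :=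
    ⟨‖a‖, norm_nonneg a, by rw [spectralSubspace_Ioi_norm, rank_bot]; exact bot_le⟩
  refine ⟨fun h => ⟨(eigenvalueSeq_nonneg a n).trans h, ?_⟩,
    fun h => csInf_le ⟨0, fun _ ht => ht.1⟩ h⟩
  by_contra! hrank
  rw [← Order.succ_le_iff, Cardinal.succ_natCast, ← Nat.cast_succ] at hrank
  obtain ⟨s, hts, hs⟩ := exists_gt_le_rank_spectralSubspace_Ioi hrank
  obtain ⟨r, ⟨-, hr⟩, hrs⟩ := exists_lt_of_csInf_lt hne (h.trans_lt hts)
  have : ((n + 1 : ℕ) : Cardinal) ≤ n :=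
    hs.trans ((Submodule.rank_mono (spectralSubspace_Ioi_antitone hrs.le)).trans hr)
  exact absurd (Nat.cast_le.1 this) (by omega)

theorem rank_spectralSubspace_Ioi_eigenvalueSeq_le (a : H →L[ℂ] H) (n : ℕ) :
    Module.rank ℂ (spectralSubspace a (Set.Ioi (eigenvalueSeq a n))) ≤ n :=
  (eigenvalueSeq_le_iff.1 le_rfl).2

theorem eigenvalueSeq_antitone (a : H →L[ℂ] H) : Antitone (eigenvalueSeq a) :=
  fun m _ hmn => eigenvalueSeq_le_iff.2 ⟨eigenvalueSeq_nonneg a m,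
    (rank_spectralSubspace_Ioi_eigenvalueSeq_le a m).trans (Nat.cast_le.2 hmn)⟩

theorem eigenvalueSeq_eq_zero_of_rank_range_le
    (h : Module.rank ℂ (LinearMap.range (a : H →ₗ[ℂ] H)) ≤ n) : eigenvalueSeq a n = 0 :=
  le_antisymm (eigenvalueSeq_le_iff.2 ⟨le_rfl, (Submodule.rank_mono
    (spectralSubspace_Ioi_le_range a le_rfl)).trans h⟩) (eigenvalueSeq_nonneg a n)

theorem eigenvalueSeq_smul {k : ℝ} (hk : 0 ≤ k) (a : H →L[ℂ] H) (n : ℕ) :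
    eigenvalueSeq (k • a) n = k * eigenvalueSeq a n := by
  rcases hk.eq_or_lt with rfl | hk
  · rw [zero_smul, zero_mul]
    exact eigenvalueSeq_eq_zero_of_rank_range_le (by simp)
  refine eq_of_forall_ge_iff fun t => ?_
  have hset : {μ | k * μ ∈ Set.Ioi t} = Set.Ioi (t / k) := by
    ext μ
    simp [div_lt_iff₀' hk]
  rw [← le_div_iff₀' hk, eigenvalueSeq_le_iff, eigenvalueSeq_le_iff, spectralSubspace_smul hk.ne',
    hset, le_div_iff₀ hk, zero_mul]

theorem eigenvalueSeq_eq_of_intertwines (e : H ≃ₗ[ℂ] H) (h : ∀ x, b (e x) = e (a x)) (n : ℕ) :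
    eigenvalueSeq b n = eigenvalueSeq a n := by
  refine eq_of_forall_ge_iff fun t => ?_
  rw [eigenvalueSeq_le_iff, eigenvalueSeq_le_iff, ← map_spectralSubspace e h,
    LinearEquiv.rank_map_eq]

theorem eigenvalueSeq_le_norm (a : H →L[ℂ] H) (n : ℕ) : eigenvalueSeq a n ≤ ‖a‖ :=
  eigenvalueSeq_le_iff.2 ⟨norm_nonneg a, by rw [spectralSubspace_Ioi_norm, rank_bot]; exact bot_le⟩

variable [CompleteSpace H]

theorem tendsto_eigenvalueSeq (ha : (a : H →ₗ[ℂ] H).IsSymmetric) (hc : IsCompactOperator a) :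
    Filter.Tendsto (eigenvalueSeq a) Filter.atTop (nhds 0) := by
  refine tendsto_order.2 ⟨fun t ht => .of_forall fun n => ht.trans_le (eigenvalueSeq_nonneg a n),
    fun t ht => ?_⟩
  have hfin := finiteDimensional_spectralSubspace ha hc (half_pos ht)
  filter_upwards [Filter.eventually_ge_atTop
    (Module.finrank ℂ (spectralSubspace a (Set.Ioi (t / 2))))] with n hn
  refine (eigenvalueSeq_le_iff.2 ⟨(half_pos ht).le, ?_⟩).trans_lt (half_lt_self ht)
  rwa [← Module.finrank_eq_rank, Nat.cast_le]

theorem eigenvalueSeq_le_add (ha : (a : H →ₗ[ℂ] H).IsSymmetric)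
    (hb : (b : H →ₗ[ℂ] H).IsSymmetric) (hbc : IsCompactOperator b) {s : ℝ} (hs : 0 ≤ s)
    (hab : ∀ x, a.reApplyInnerSelf x ≤ b.reApplyInnerSelf x + s * ‖x‖ ^ 2) (n : ℕ) :
    eigenvalueSeq a n ≤ eigenvalueSeq b n + s :=
  eigenvalueSeq_le_iff.2 ⟨add_nonneg (eigenvalueSeq_nonneg b n) hs,
    rank_spectralSubspace_Ioi_add_le ha hb hbc hab
      (rank_spectralSubspace_Ioi_eigenvalueSeq_le b n)⟩

theorem eigenvalueSeq_mono (ha : (a : H →ₗ[ℂ] H).IsSymmetric) (hb : (b : H →ₗ[ℂ] H).IsSymmetric)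
    (hbc : IsCompactOperator b) (hab : a ≤ b) (n : ℕ) :
    eigenvalueSeq a n ≤ eigenvalueSeq b n := by
  have hform (x : H) : a.reApplyInnerSelf x ≤ b.reApplyInnerSelf x + 0 * ‖x‖ ^ 2 := by
    have hnonneg := ((ContinuousLinearMap.le_def a b).1 hab).re_inner_nonneg_left x
    rw [sub_apply, inner_sub_left, map_sub] at hnonneg
    simpa [ContinuousLinearMap.reApplyInnerSelf_apply] using hnonneg
  simpa using eigenvalueSeq_le_add ha hb hbc le_rfl hform n

theorem eigenvalueSeq_le_add_norm_sub (ha : (a : H →ₗ[ℂ] H).IsSymmetric)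
    (hb : (b : H →ₗ[ℂ] H).IsSymmetric) (hbc : IsCompactOperator b) (n : ℕ) :
    eigenvalueSeq a n ≤ eigenvalueSeq b n + ‖a - b‖ := by
  refine eigenvalueSeq_le_add ha hb hbc (norm_nonneg _) (fun x => ?_) n
  have hle : RCLike.re (inner ℂ ((a - b) x) x) ≤ ‖a - b‖ * ‖x‖ ^ 2 := calc
    _ ≤ ‖(a - b) x‖ * ‖x‖ := re_inner_le_norm _ _
    _ ≤ ‖a - b‖ * ‖x‖ * ‖x‖ := by gcongr; exact (a - b).le_opNorm x
    _ = ‖a - b‖ * ‖x‖ ^ 2 := by ring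
  rw [sub_apply, inner_sub_left, map_sub] at hle
  exact sub_le_iff_le_add'.1 hle

end EigenvalueSeq

section IsPosVanishing

variable {H : Type*} [NormedAddCommGroup H] [InnerProductSpace ℂ H] {a : H →L[ℂ] H} {f g : ℝ → ℝ}

theorem IsPosVanishing.add (hf : IsPosVanishing a f) (hg : IsPosVanishing a g) :
    IsPosVanishing a fun x => f x + g x :=
  ⟨hf.continuousOn.add hg.continuousOn, fun x hx => add_nonneg (hf.nonneg x hx) (hg.nonneg x hx),
    by rw [hf.map_zero, hg.map_zero, add_zero]⟩

theorem IsPosVanishing.min_const (hf : IsPosVanishing a f) {c : ℝ} (hc : 0 ≤ c) :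
    IsPosVanishing a fun x => min (f x) c :=
  ⟨hf.continuousOn.inf continuousOn_const, fun x hx => le_min (hf.nonneg x hx) hc,
    by rw [hf.map_zero, min_eq_left hc]⟩

theorem IsPosVanishing.posPart_sub_const (hf : IsPosVanishing a f) {c : ℝ} (hc : 0 ≤ c) :
    IsPosVanishing a fun x => max (f x - c) 0 :=
  ⟨(hf.continuousOn.sub continuousOn_const).sup continuousOn_const, fun _ _ => le_max_right _ _,
    by rw [hf.map_zero, zero_sub, max_eq_right (neg_nonpos.2 hc)]⟩

end IsPosVanishing

section PosCompact

variable {H : Type*} [NormedAddCommGroup H] [InnerProductSpace ℂ H] [CompleteSpace H]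

theorem isSymmetric_posCompact (a : posCompact H) :
    ((a : H →L[ℂ] H) : H →ₗ[ℂ] H).IsSymmetric :=
  a.2.1.isSelfAdjoint.isSymmetric

theorem continuous_eigenvalueSeq (n : ℕ) :
    Continuous fun a : posCompact H => eigenvalueSeq (a : H →L[ℂ] H) n := by
  refine (LipschitzWith.of_le_add fun a b => ?_).continuous
  rw [Subtype.dist_eq, dist_eq_norm]
  exact eigenvalueSeq_le_add_norm_sub (isSymmetric_posCompact a) (isSymmetric_posCompact b) b.2.2 n

theorem eigenvalueSeq_unitaryConj (u : unitary (H →L[ℂ] H)) (a : posCompact H) (n : ℕ) :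
    eigenvalueSeq (unitaryConj u a : H →L[ℂ] H) n = eigenvalueSeq (a : H →L[ℂ] H) n := by
  refine eigenvalueSeq_eq_of_intertwines (Unitary.linearIsometryEquiv u).toLinearEquiv
    (fun x => congr_arg (fun y => (u : H →L[ℂ] H) ((a : H →L[ℂ] H) y)) ?_) n
  exact DFunLike.congr_fun (Unitary.star_mul_self_of_mem u.2) x

theorem funCalc_add (a : posCompact H) {f g : ℝ → ℝ} (hf : IsPosVanishing (a : H →L[ℂ] H) f)
    (hg : IsPosVanishing (a : H →L[ℂ] H) g) :
    funCalc a f hf + funCalc a g hg = funCalc a _ (hf.add hg) :=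
  Subtype.ext (cfc_add (a := (a : H →L[ℂ] H)) f g hf.continuousOn hg.continuousOn).symm

theorem eigenvalueSeq_funCalc_le_iff (a : posCompact H) {f : ℝ → ℝ}
    (hf : IsPosVanishing (a : H →L[ℂ] H) f) {n : ℕ} {t : ℝ} :
    eigenvalueSeq (funCalc a f hf : H →L[ℂ] H) n ≤ t ↔
      0 ≤ t ∧ Module.rank ℂ (spectralSubspace (a : H →L[ℂ] H) {μ | t < f μ}) ≤ n := by
  have hcfc : ActsOnEigenvectors (a : H →L[ℂ] H) (funCalc a f hf : H →L[ℂ] H) f :=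
    actsOnEigenvectors_cfc a.2.1.isSelfAdjoint hf.continuousOn
  rw [eigenvalueSeq_le_iff, hcfc.rank_spectralSubspace_le_iff (isSymmetric_posCompact a) a.2.2
    (isSymmetric_posCompact _)]

theorem ComonotonicOn.superlevel_subset_or {f g : ℝ → ℝ} {σ : Set ℝ} (h : ComonotonicOn f g σ)
    (t s : ℝ) : σ ∩ {x | t < f x} ⊆ {x | s < g x} ∨ σ ∩ {x | s < g x} ⊆ {x | t < f x} := by
  by_contra! hc
  simp only [Set.not_subset, Set.mem_inter_iff, Set.mem_ofPred_eq, not_lt] at hc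
  obtain ⟨⟨x, ⟨hx, hfx⟩, hgx⟩, y, ⟨hy, hgy⟩, hfy⟩ := hc
  exact (h x hx y hy).not_gt (mul_neg_of_pos_of_neg (by linarith) (by linarith))

theorem funCalc_mono (a : posCompact H) {f g : ℝ → ℝ} (hf : IsPosVanishing (a : H →L[ℂ] H) f)
    (hg : IsPosVanishing (a : H →L[ℂ] H) g) (hfg : ∀ x ∈ spectrum ℝ (a : H →L[ℂ] H), f x ≤ g x) :
    funCalc a f hf ≤ funCalc a g hg :=
  cfc_mono (a := (a : H →L[ℂ] H)) hfg hf.continuousOn hg.continuousOn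

theorem eigenvalueSeq_le_of_le {a b : posCompact H} (hab : a ≤ b) (n : ℕ) :
    eigenvalueSeq (a : H →L[ℂ] H) n ≤ eigenvalueSeq (b : H →L[ℂ] H) n :=
  eigenvalueSeq_mono (isSymmetric_posCompact a) (isSymmetric_posCompact b) b.2.2 hab n

theorem eigenvalueSeq_funCalc_add_le (a : posCompact H) {f g : ℝ → ℝ}
    (hf : IsPosVanishing (a : H →L[ℂ] H) f) (hg : IsPosVanishing (a : H →L[ℂ] H) g)
    (hcom : ComonotonicOn f g (spectrum ℝ (a : H →L[ℂ] H))) (n : ℕ) :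
    eigenvalueSeq (funCalc a _ (hf.add hg) : H →L[ℂ] H) n ≤
      eigenvalueSeq (funCalc a f hf : H →L[ℂ] H) n +
        eigenvalueSeq (funCalc a g hg : H →L[ℂ] H) n := by
  obtain ⟨ht, htf⟩ := (eigenvalueSeq_funCalc_le_iff a hf (n := n)).1 le_rfl
  obtain ⟨hs, hsg⟩ := (eigenvalueSeq_funCalc_le_iff a hg (n := n)).1 le_rfl
  set t := eigenvalueSeq (funCalc a f hf : H →L[ℂ] H) n
  set s := eigenvalueSeq (funCalc a g hg : H →L[ℂ] H) n
  refine (eigenvalueSeq_funCalc_le_iff a _).2 ⟨add_nonneg ht hs, ?_⟩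
  rcases hcom.superlevel_subset_or t s with hsub | hsub
  · refine (Submodule.rank_mono (spectralSubspace_mono fun μ ⟨hμ, hlt⟩ => ?_)).trans hsg
    by_contra hle
    have hfμ : f μ ≤ t := not_lt.1 fun hlt' => hle (hsub ⟨hμ, hlt'⟩)
    exact (add_le_add hfμ (not_lt.1 hle)).not_gt hlt
  · refine (Submodule.rank_mono (spectralSubspace_mono fun μ ⟨hμ, hlt⟩ => ?_)).trans htf
    by_contra hle
    have hgμ : g μ ≤ s := not_lt.1 fun hlt' => hle (hsub ⟨hμ, hlt'⟩)
    exact (add_le_add (not_lt.1 hle) hgμ).not_gt hlt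

theorem le_eigenvalueSeq_funCalc_add (a : posCompact H) {f g : ℝ → ℝ}
    (hf : IsPosVanishing (a : H →L[ℂ] H) f) (hg : IsPosVanishing (a : H →L[ℂ] H) g)
    (hcom : ComonotonicOn f g (spectrum ℝ (a : H →L[ℂ] H))) (n : ℕ) :
    eigenvalueSeq (funCalc a f hf : H →L[ℂ] H) n + eigenvalueSeq (funCalc a g hg : H →L[ℂ] H) n ≤
      eigenvalueSeq (funCalc a _ (hf.add hg) : H →L[ℂ] H) n := by
  have hfr := eigenvalueSeq_le_of_le (funCalc_mono a hf (hf.add hg)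
    fun x hx => le_add_of_nonneg_right (hg.nonneg x hx)) n
  have hgr := eigenvalueSeq_le_of_le (funCalc_mono a hg (hf.add hg)
    fun x hx => le_add_of_nonneg_left (hf.nonneg x hx)) n
  obtain ⟨-, hrank⟩ := (eigenvalueSeq_funCalc_le_iff a (hf.add hg) (n := n)).1 le_rfl
  have hf0 := eigenvalueSeq_nonneg (funCalc a f hf : H →L[ℂ] H) n
  have hg0 := eigenvalueSeq_nonneg (funCalc a g hg : H →L[ℂ] H) n
  set r := eigenvalueSeq (funCalc a _ (hf.add hg) : H →L[ℂ] H) n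
  by_contra! hlt
  obtain ⟨t, s, ht, hs, htf, hsg, hts⟩ : ∃ t s : ℝ, 0 ≤ t ∧ 0 ≤ s ∧
      t < eigenvalueSeq (funCalc a f hf : H →L[ℂ] H) n ∧
      s < eigenvalueSeq (funCalc a g hg : H →L[ℂ] H) n ∧ r = t + s := by
    set p := eigenvalueSeq (funCalc a f hf : H →L[ℂ] H) n
    set q := eigenvalueSeq (funCalc a g hg : H →L[ℂ] H) n
    exact ⟨(p + r - q) / 2, (q + r - p) / 2, by linarith, by linarith, by linarith, by linarith,
      by ring⟩
  rw [hts] at hrank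
  rw [← not_le, eigenvalueSeq_funCalc_le_iff] at htf hsg
  rcases hcom.superlevel_subset_or t s with hsub | hsub
  · refine htf ⟨ht, (Submodule.rank_mono (spectralSubspace_mono fun μ hμ => ?_)).trans hrank⟩
    have hfμ : t < f μ := hμ.2
    have hgμ : s < g μ := hsub hμ
    exact add_lt_add hfμ hgμ
  · refine hsg ⟨hs, (Submodule.rank_mono (spectralSubspace_mono fun μ hμ => ?_)).trans hrank⟩
    have hfμ : t < f μ := hsub hμ
    have hgμ : s < g μ := hμ.2
    exact add_lt_add hfμ hgμ

theorem eigenvalueSeq_funCalc_add (a : posCompact H) {f g : ℝ → ℝ}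
    (hf : IsPosVanishing (a : H →L[ℂ] H) f) (hg : IsPosVanishing (a : H →L[ℂ] H) g)
    (hcom : ComonotonicOn f g (spectrum ℝ (a : H →L[ℂ] H))) (n : ℕ) :
    eigenvalueSeq ((funCalc a f hf + funCalc a g hg : posCompact H) : H →L[ℂ] H) n =
      eigenvalueSeq (funCalc a f hf : H →L[ℂ] H) n +
        eigenvalueSeq (funCalc a g hg : H →L[ℂ] H) n := by
  rw [funCalc_add]
  exact (eigenvalueSeq_funCalc_add_le a hf hg hcom n).antisymm
    (le_eigenvalueSeq_funCalc_add a hf hg hcom n)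

end PosCompact

section AbelSummation

theorem tsum_ofReal_sub_succ {l : ℕ → ℝ} (hl : Antitone l)
    (hl0 : Filter.Tendsto l Filter.atTop (nhds 0)) :
    ∑' i, ENNReal.ofReal (l i - l (i + 1)) = ENNReal.ofReal (l 0) := by
  have hnonneg (i : ℕ) : 0 ≤ l i - l (i + 1) := sub_nonneg.2 (hl i.le_succ)
  have hsum : HasSum (fun i => l i - l (i + 1)) (l 0) := by
    rw [hasSum_iff_tendsto_nat_of_nonneg hnonneg]
    simp only [Finset.sum_range_sub']
    simpa using tendsto_const_nhds.sub hl0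
  rw [← ENNReal.ofReal_tsum_of_nonneg hnonneg hsum.summable, hsum.tsum_eq]

theorem tsum_sub_succ_mul {l : ℕ → ℝ} (hl : Antitone l)
    (hl0 : Filter.Tendsto l Filter.atTop (nhds 0)) {α : ℕ → ℝ≥0} (hα : Monotone α)
    (hα0 : α 0 = 0) :
    ∑' i, ENNReal.ofReal (l i - l (i + 1)) * (α (i + 1) : ℝ≥0∞) =
      ∑' i, ENNReal.ofReal (l i) * ((α (i + 1) - α i : ℝ≥0) : ℝ≥0∞) := by
  have hhead (i : ℕ) : (α (i + 1) : ℝ≥0∞) =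
      ∑' j, if j ≤ i then ((α (j + 1) - α j : ℝ≥0) : ℝ≥0∞) else 0 := by
    rw [tsum_eq_sum (s := Finset.range (i + 1)) (fun j hj => if_neg (by simpa using hj)),
      Finset.sum_congr rfl fun j hj => if_pos (by simpa [Nat.lt_succ_iff] using hj),
      ← ENNReal.ofNNReal_finsetSum, Finset.sum_range_tsub hα, hα0, tsub_zero]
  have htail (j : ℕ) : ∑' i, (if j ≤ i then ENNReal.ofReal (l i - l (i + 1)) else 0) =
      ENNReal.ofReal (l j) := by
    have htel := tsum_ofReal_sub_succ (l := fun i => l (i + j))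
      (fun _ _ hik => hl (Nat.add_le_add_right hik j)) ((Filter.tendsto_add_atTop_iff_nat j).2 hl0)
    rw [zero_add] at htel
    rw [← htel, ← Summable.sum_add_tsum_nat_add' (k := j) ENNReal.summable,
      Finset.sum_eq_zero (fun i hi => if_neg (by simpa using hi)), zero_add]
    exact tsum_congr fun i => by rw [if_pos (Nat.le_add_left j i), add_right_comm]
  calc ∑' i, ENNReal.ofReal (l i - l (i + 1)) * (α (i + 1) : ℝ≥0∞)
      = ∑' i, ∑' j, (if j ≤ i then ENNReal.ofReal (l i - l (i + 1)) else 0) *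
          ((α (j + 1) - α j : ℝ≥0) : ℝ≥0∞) := by
        refine tsum_congr fun i => ?_
        rw [hhead, ← ENNReal.tsum_mul_left]
        exact tsum_congr fun j => by split_ifs <;> simp
    _ = ∑' j, ∑' i, (if j ≤ i then ENNReal.ofReal (l i - l (i + 1)) else 0) *
          ((α (j + 1) - α j : ℝ≥0) : ℝ≥0∞) := ENNReal.tsum_comm
    _ = ∑' j, ENNReal.ofReal (l j) * ((α (j + 1) - α j : ℝ≥0) : ℝ≥0∞) :=
        tsum_congr fun j => by rw [ENNReal.tsum_mul_right, htail]

end AbelSummation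

section choquetTrace

variable {H : Type*} [NormedAddCommGroup H] [InnerProductSpace ℂ H] [CompleteSpace H]
  {α : ℕ → ℝ≥0}

theorem choquetTrace_eq_tsum (hα : Monotone α) (hα0 : α 0 = 0) (a : posCompact H) :
    choquetTrace α a = ∑' i, ENNReal.ofReal (eigenvalueSeq (a : H →L[ℂ] H) i) *
      ((α (i + 1) - α i : ℝ≥0) : ℝ≥0∞) :=
  tsum_sub_succ_mul (eigenvalueSeq_antitone _)
    (tendsto_eigenvalueSeq (isSymmetric_posCompact a) a.2.2) hα hα0

theorem isComonotonicAdditive_choquetTrace (hα : Monotone α) (hα0 : α 0 = 0) :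
    IsComonotonicAdditive (choquetTrace α : posCompact H → ℝ≥0∞) := by
  intro a f g hf hg hfg
  simp only [choquetTrace_eq_tsum hα hα0]
  rw [← ENNReal.tsum_add]
  refine tsum_congr fun i => ?_
  rw [eigenvalueSeq_funCalc_add a hf hg hfg, ENNReal.ofReal_add (eigenvalueSeq_nonneg _ _)
    (eigenvalueSeq_nonneg _ _), add_mul]

theorem isUnitarilyInvariant_choquetTrace (α : ℕ → ℝ≥0) :
    IsUnitarilyInvariant (choquetTrace α : posCompact H → ℝ≥0∞) := by
  intro u a
  simp only [choquetTrace, eigenvalueSeq_unitaryConj]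

theorem monotone_choquetTrace (hα : Monotone α) (hα0 : α 0 = 0) :
    Monotone (choquetTrace α : posCompact H → ℝ≥0∞) := by
  intro a b hab
  simp only [choquetTrace_eq_tsum hα hα0]
  gcongr with i
  exact eigenvalueSeq_le_of_le hab i

theorem isPosHomogeneous_choquetTrace (α : ℕ → ℝ≥0) :
    IsPosHomogeneous (choquetTrace α : posCompact H → ℝ≥0∞) := by
  intro k a
  rw [choquetTrace, choquetTrace, ← ENNReal.tsum_mul_left]
  refine tsum_congr fun i => ?_
  have hsmul (n : ℕ) : eigenvalueSeq ((k • a : posCompact H) : H →L[ℂ] H) n =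
      k * eigenvalueSeq (a : H →L[ℂ] H) n := eigenvalueSeq_smul k.2 _ n
  rw [hsmul, hsmul, ← mul_sub, ENNReal.ofReal_mul k.coe_nonneg, ENNReal.ofReal_coe_nnreal,
    mul_assoc]

theorem lowerSemicontinuous_choquetTrace (hα : Monotone α) (hα0 : α 0 = 0) :
    LowerSemicontinuous (choquetTrace α : posCompact H → ℝ≥0∞) := by
  rw [funext (choquetTrace_eq_tsum hα hα0)]
  refine lowerSemicontinuous_tsum fun i => Continuous.lowerSemicontinuous ?_
  exact (ENNReal.continuous_mul_const ENNReal.coe_ne_top).comp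
    (ENNReal.continuous_ofReal.comp (continuous_eigenvalueSeq i))

theorem isFiniteOnFiniteRank_choquetTrace (α : ℕ → ℝ≥0) :
    IsFiniteOnFiniteRank (choquetTrace α : posCompact H → ℝ≥0∞) := by
  intro a _
  set r := Module.finrank ℂ (LinearMap.range ((a : H →L[ℂ] H) : H →ₗ[ℂ] H))
  have hzero (n : ℕ) (hn : r ≤ n) : eigenvalueSeq (a : H →L[ℂ] H) n = 0 :=
    eigenvalueSeq_eq_zero_of_rank_range_le <| by
      rwa [← Module.finrank_eq_rank, Nat.cast_le]
  rw [choquetTrace, tsum_eq_sum (s := Finset.range r)]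
  · exact ENNReal.sum_lt_top.2 fun i _ =>
      ENNReal.mul_lt_top ENNReal.ofReal_lt_top ENNReal.coe_lt_top
  · intro i hi
    have hri : r ≤ i := not_lt.1 (mt Finset.mem_range.2 hi)
    rw [hzero i hri, hzero (i + 1) (hri.trans i.le_succ), sub_zero, ENNReal.ofReal_zero, zero_mul]

end choquetTrace

section Submodule

variable {𝕜 E : Type*}

theorem exists_submodule_le_finrank_eq [Field 𝕜] [AddCommGroup E] [Module 𝕜 E]
    {N : Submodule 𝕜 E} {n : ℕ} (h : n ≤ Module.finrank 𝕜 N) : ∃ M ≤ N, Module.finrank 𝕜 M = n := by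
  obtain ⟨v, hv⟩ := exists_linearIndependent_of_le_finrank h
  have hvE : LinearIndependent 𝕜 fun i => (v i : E) := hv.map' N.subtype N.ker_subtype
  refine ⟨Submodule.span 𝕜 (Set.range fun i => (v i : E)), ?_, ?_⟩
  · rw [Submodule.span_le, Set.range_subset_iff]
    exact fun i => (v i).2
  · rw [finrank_span_eq_card hvE, Fintype.card_fin]

theorem exists_submodule_finrank_maximal [Field 𝕜] [AddCommGroup E] [Module 𝕜 E] (n : ℕ) :
    ∃ (M : Submodule 𝕜 E) (_ : FiniteDimensional 𝕜 M), Module.finrank 𝕜 M ≤ n ∧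
      ∀ (N : Submodule 𝕜 E) [FiniteDimensional 𝕜 N], Module.finrank 𝕜 N ≤ n →
        Module.finrank 𝕜 N ≤ Module.finrank 𝕜 M := by
  let dims : Set ℕ := {k | k ≤ n ∧ ∃ (M : Submodule 𝕜 E) (_ : FiniteDimensional 𝕜 M),
    Module.finrank 𝕜 M = k}
  have hfin : dims.Finite := (Set.finite_Iic n).subset fun _ hk => hk.1
  have hne : dims.Nonempty := ⟨0, n.zero_le, ⊥, inferInstance, finrank_bot 𝕜 E⟩
  obtain ⟨_, ⟨hMn, M, hM, rfl⟩, hmax⟩ := Set.exists_max_image dims id hfin hne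
  exact ⟨M, hM, hMn, fun N hN hNn => hmax _ ⟨hNn, N, hN, rfl⟩⟩

variable [RCLike 𝕜] [NormedAddCommGroup E] [InnerProductSpace 𝕜 E]

theorem exists_linearIsometryEquiv_extend (F : Submodule 𝕜 E) [F.HasOrthogonalProjection]
    (V : F ≃ₗᵢ[𝕜] F) : ∃ e : E ≃ₗᵢ[𝕜] E, ∀ x : F, e x = V x := by
  refine ⟨F.orthogonalDecomposition.trans ((LinearIsometryEquiv.withLpProdCongr 2 V
    (LinearIsometryEquiv.refl 𝕜 Fᗮ)).trans F.orthogonalDecomposition.symm), fun x => ?_⟩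
  simp [Submodule.orthogonalProjectionOnto_orthogonal_apply_eq_zero]

theorem exists_linearIsometryEquiv_map_eq {M N : Submodule 𝕜 E} [FiniteDimensional 𝕜 M]
    [FiniteDimensional 𝕜 N] (h : Module.finrank 𝕜 M = Module.finrank 𝕜 N) :
    ∃ e : E ≃ₗᵢ[𝕜] E, M.map (e.toLinearEquiv : E →ₗ[𝕜] E) = N := by
  let w : M ≃ₗᵢ[𝕜] N := (stdOrthonormalBasis 𝕜 M).equiv (stdOrthonormalBasis 𝕜 N) (finCongr h)
  let j : M.submoduleOf (M ⊔ N) ≃ₗ[𝕜] M := Submodule.submoduleOfEquivOfLe le_sup_left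
  let L : M.submoduleOf (M ⊔ N) →ₗᵢ[𝕜] ↥(M ⊔ N) :=
    ⟨Submodule.inclusion le_sup_right ∘ₗ (w.toLinearEquiv : M →ₗ[𝕜] N) ∘ₗ
      (j : M.submoduleOf (M ⊔ N) →ₗ[𝕜] M), fun x => w.norm_map (j x)⟩
  obtain ⟨e, he⟩ := exists_linearIsometryEquiv_extend (M ⊔ N)
    (L.extend.toLinearIsometryEquiv rfl)
  refine ⟨e, Submodule.eq_of_le_of_finrank_eq ?_ (by rw [LinearEquiv.finrank_map_eq, h])⟩
  rintro _ ⟨x, hx, rfl⟩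
  have hex : e x = w ⟨x, hx⟩ := (he ⟨x, Submodule.mem_sup_left hx⟩).trans
    (congr_arg Subtype.val (L.extend_apply ⟨⟨x, Submodule.mem_sup_left hx⟩, hx⟩))
  have : (e x : E) ∈ N := hex ▸ (w ⟨x, hx⟩).2
  exact this

end Submodule

section FiniteProj

variable {H : Type*} [NormedAddCommGroup H] [InnerProductSpace ℂ H]

theorem isCompactOperator_starProjection (M : Submodule ℂ H) [FiniteDimensional ℂ M] :
    IsCompactOperator M.starProjection :=
  ((isCompactOperator_id (E := M)).comp_clm M.orthogonalProjectionOnto).clm_comp M.subtypeL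

theorem le_spectralSubspace_starProjection (M : Submodule ℂ H) [M.HasOrthogonalProjection]
    {S : Set ℝ} (hS : 1 ∈ S) : M ≤ spectralSubspace M.starProjection S := fun x hx =>
  mem_spectralSubspace hS <| by
    rw [Complex.ofReal_one, one_smul, Submodule.starProjection_eq_self_iff.2 hx]

variable [CompleteSpace H]

/-- The orthogonal projection onto a finite-dimensional subspace, as an element of `K(H)^+`. A
functional as in the theorem is determined by its values on these. -/
def finiteProj (M : Submodule ℂ H) [FiniteDimensional ℂ M] : posCompact H :=
  ⟨M.starProjection, (isStarProjection_starProjection (U := M)).nonneg,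
    isCompactOperator_starProjection M⟩

theorem finiteProj_bot : finiteProj (⊥ : Submodule ℂ H) = 0 :=
  Subtype.ext Submodule.starProjection_bot

theorem finiteProj_mono {M N : Submodule ℂ H} [FiniteDimensional ℂ M] [FiniteDimensional ℂ N]
    (h : M ≤ N) : finiteProj M ≤ finiteProj N :=
  Submodule.starProjection_le_starProjection_iff.2 h

theorem range_finiteProj (M : Submodule ℂ H) [FiniteDimensional ℂ M] :
    LinearMap.range ((finiteProj M : H →L[ℂ] H) : H →ₗ[ℂ] H) = M :=
  M.range_starProjection

theorem eigenvalueSeq_finiteProj (M : Submodule ℂ H) [FiniteDimensional ℂ M] (i : ℕ) :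
    eigenvalueSeq (finiteProj M : H →L[ℂ] H) i = if i < Module.finrank ℂ M then 1 else 0 := by
  split_ifs with hi
  · refine le_antisymm ((eigenvalueSeq_le_norm _ i).trans M.starProjection_norm_le) ?_
    by_contra! hlt
    have hrank := (Submodule.rank_mono (le_spectralSubspace_starProjection M hlt)).trans
      (rank_spectralSubspace_Ioi_eigenvalueSeq_le _ i)
    rw [← Module.finrank_eq_rank, Nat.cast_le] at hrank
    exact hi.not_ge hrank
  · refine eigenvalueSeq_eq_zero_of_rank_range_le ?_
    rw [range_finiteProj, ← Module.finrank_eq_rank, Nat.cast_le]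
    exact not_lt.1 hi

theorem choquetTrace_finiteProj {α : ℕ → ℝ≥0} (hα0 : α 0 = 0) (M : Submodule ℂ H)
    [FiniteDimensional ℂ M] : choquetTrace α (finiteProj M) = α (Module.finrank ℂ M) := by
  simp only [choquetTrace, eigenvalueSeq_finiteProj]
  rcases Module.finrank ℂ M with _ | m
  · simp [hα0]
  · rw [tsum_eq_single m]
    · simp
    · intro i hi
      rcases lt_or_gt_of_ne hi with h | h
      · simp [h, h.trans m.lt_succ_self]
      · rw [if_neg (by omega), if_neg (by omega)]
        simp

theorem exists_unitaryConj_finiteProj_eq {M N : Submodule ℂ H} [FiniteDimensional ℂ M]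
    [FiniteDimensional ℂ N] (h : Module.finrank ℂ M = Module.finrank ℂ N) :
    ∃ u : unitary (H →L[ℂ] H), unitaryConj u (finiteProj M) = finiteProj N := by
  obtain ⟨e, rfl⟩ := exists_linearIsometryEquiv_map_eq h
  let u : unitary (H →L[ℂ] H) := Unitary.linearIsometryEquiv.symm e
  have hstar (x : H) : star (u : H →L[ℂ] H) x = e.symm x :=
    (e.eq_symm_apply).2 (DFunLike.congr_fun (Unitary.mul_star_self_of_mem u.2) x)
  refine ⟨u, Subtype.ext (ContinuousLinearMap.ext fun x => ?_)⟩
  change e (M.starProjection (star (u : H →L[ℂ] H) x)) = _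
  rw [hstar]
  exact (Submodule.starProjection_map_apply e M x).symm

theorem exists_eq_finiteProj {p : posCompact H} (hp : IsIdempotentElem (p : H →L[ℂ] H)) :
    ∃ (M : Submodule ℂ H) (_ : FiniteDimensional ℂ M), p = finiteProj M := by
  have hstar : IsStarProjection (p : H →L[ℂ] H) := ⟨hp, p.2.1.isSelfAdjoint⟩
  obtain ⟨_, hproj⟩ := isStarProjection_iff_eq_starProjection_range.1 hstar
  have hle : (p : H →L[ℂ] H).range ≤ spectralSubspace (p : H →L[ℂ] H) (Set.Ioi (1 / 2)) := by
    have := le_spectralSubspace_starProjection (p : H →L[ℂ] H).range (S := Set.Ioi (1 / 2))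
      (by norm_num)
    rwa [← hproj] at this
  have := finiteDimensional_spectralSubspace (isSymmetric_posCompact p) p.2.2 one_half_pos
  exact ⟨(p : H →L[ℂ] H).range, Submodule.finiteDimensional_of_le hle, Subtype.ext hproj⟩

theorem exists_funCalc_eq_smul_finiteProj (a : posCompact H) {f : ℝ → ℝ}
    (hf : IsPosVanishing (a : H →L[ℂ] H) f) {c : ℝ≥0} (hc : c ≠ 0)
    (hfc : ∀ x ∈ spectrum ℝ (a : H →L[ℂ] H), f x = 0 ∨ f x = c) :
    ∃ (M : Submodule ℂ H) (_ : FiniteDimensional ℂ M), funCalc a f hf = c • finiteProj M := by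
  have hsq : cfc f (a : H →L[ℂ] H) * cfc f (a : H →L[ℂ] H) = c • cfc f (a : H →L[ℂ] H) := by
    rw [← cfc_mul f f _ hf.continuousOn hf.continuousOn, NNReal.smul_def,
      ← cfc_smul (c : ℝ) f _ hf.continuousOn]
    refine cfc_congr fun x hx => ?_
    rcases hfc x hx with h | h <;> simp [h]
  have hidem : IsIdempotentElem ((c⁻¹ • funCalc a f hf : posCompact H) : H →L[ℂ] H) := by
    change (c⁻¹ • cfc f (a : H →L[ℂ] H)) * (c⁻¹ • cfc f (a : H →L[ℂ] H)) = c⁻¹ • cfc f _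
    rw [smul_mul_smul_comm, hsq, smul_smul, mul_assoc, inv_mul_cancel₀ hc, mul_one]
  obtain ⟨M, hM, hproj⟩ := exists_eq_finiteProj hidem
  have hop : c⁻¹ • cfc f (a : H →L[ℂ] H) = finiteProj M := congr_arg Subtype.val hproj
  refine ⟨M, hM, Subtype.ext ?_⟩
  change cfc f (a : H →L[ℂ] H) = c • (finiteProj M : H →L[ℂ] H)
  rw [← hop, smul_inv_smul₀ hc]

end FiniteProj

section FunctionalCalculus

variable {H : Type*} [NormedAddCommGroup H] [InnerProductSpace ℂ H] [CompleteSpace H]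

theorem isPosVanishing_id (a : posCompact H) : IsPosVanishing (a : H →L[ℂ] H) id :=
  ⟨continuousOn_id, fun _ hx => spectrum_nonneg_of_nonneg a.2.1 hx, rfl⟩

theorem funCalc_id (a : posCompact H) : funCalc a id (isPosVanishing_id a) = a :=
  Subtype.ext (cfc_id ℝ (a : H →L[ℂ] H) a.2.1.isSelfAdjoint)

theorem funCalc_eq_zero (a : posCompact H) {f : ℝ → ℝ} (hf : IsPosVanishing (a : H →L[ℂ] H) f)
    (h : ∀ x ∈ spectrum ℝ (a : H →L[ℂ] H), f x = 0) : funCalc a f hf = 0 :=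
  Subtype.ext ((cfc_congr h).trans (cfc_const_zero ℝ (a : H →L[ℂ] H)))

theorem funCalc_eq_posPart_add_min (a : posCompact H) {f : ℝ → ℝ}
    (hf : IsPosVanishing (a : H →L[ℂ] H) f) {c : ℝ} (hc : 0 ≤ c) :
    funCalc a f hf = funCalc a _ (hf.posPart_sub_const hc) + funCalc a _ (hf.min_const hc) := by
  rw [funCalc_add]
  congr 1
  funext x
  rcases le_total (f x) c with h | h <;> simp [h]

theorem dist_funCalc_posPart_sub_le (a : posCompact H) {f : ℝ → ℝ}
    (hf : IsPosVanishing (a : H →L[ℂ] H) f) {c : ℝ} (hc : 0 ≤ c) :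
    dist (funCalc a _ (hf.posPart_sub_const hc)) (funCalc a f hf) ≤ c := by
  rw [funCalc_eq_posPart_add_min a hf hc, Subtype.dist_eq, Submodule.coe_add, dist_self_add_right]
  refine norm_cfc_le hc fun x hx => ?_
  rw [Real.norm_of_nonneg ((hf.min_const hc).nonneg x hx)]
  exact min_le_right _ _

theorem finite_spectrum_inter_Ioi {a : H →L[ℂ] H} (ha : (a : H →ₗ[ℂ] H).IsSymmetric)
    (hc : IsCompactOperator a) {t : ℝ} (ht : 0 < t) : (spectrum ℝ a ∩ Set.Ioi t).Finite := by
  have hev (μ : ↥(spectrum ℝ a ∩ Set.Ioi t)) :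
      ∃ x : H, Module.End.HasEigenvector (a : H →ₗ[ℂ] H) ((μ : ℝ) : ℂ) x := by
    have h0 : ((μ : ℝ) : ℂ) ≠ 0 := Complex.ofReal_ne_zero.2 (ht.trans μ.2.2).ne'
    exact ((hc.hasEigenvalue_iff_mem_spectrum h0).2
      (spectrum.algebraMap_mem ℂ μ.2.1)).exists_hasEigenvector
  choose v hv using hev
  have hindep : LinearIndependent ℂ v := Module.End.eigenvectors_linearIndependent' _
    (fun μ : ↥(spectrum ℝ a ∩ Set.Ioi t) => ((μ : ℝ) : ℂ))
    (Complex.ofReal_injective.comp Subtype.val_injective) v hv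
  have hmem (μ : ↥(spectrum ℝ a ∩ Set.Ioi t)) : v μ ∈ spectralSubspace a (Set.Ioi t) :=
    mem_spectralSubspace μ.2.2 (hv μ).apply_eq_smul
  have := finiteDimensional_spectralSubspace ha hc ht
  have hindep' : LinearIndependent ℂ
      fun μ => (⟨v μ, hmem μ⟩ : spectralSubspace a (Set.Ioi t)) :=
    LinearIndependent.of_comp (Submodule.subtype _) hindep
  exact Set.finite_coe_iff.1 hindep'.finite

end FunctionalCalculus

section Uniqueness

variable {H : Type*} [NormedAddCommGroup H] [InnerProductSpace ℂ H] [CompleteSpace H]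
  {φ ψ : posCompact H → ℝ≥0∞}

theorem IsPosHomogeneous.map_zero (hφ : IsPosHomogeneous φ) : φ 0 = 0 := by
  have h := hφ 0 0
  rwa [zero_smul, ENNReal.coe_zero, zero_mul] at h

theorem IsComonotonicAdditive.isMonotoneIncreasingAdditive (hφ : IsComonotonicAdditive φ) :
    IsMonotoneIncreasingAdditive φ := by
  intro a f g hf hg hfm hgm
  refine hφ a f g hf hg fun x hx y hy => ?_
  rcases le_total x y with h | h
  · exact mul_nonneg_of_nonpos_of_nonpos (sub_nonpos.2 (hfm hx hy h)) (sub_nonpos.2 (hgm hx hy h))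
  · exact mul_nonneg (sub_nonneg.2 (hfm hy hx h)) (sub_nonneg.2 (hgm hy hx h))

theorem IsMonotoneIncreasingAdditive.map_funCalc_eq_add (hφ : IsMonotoneIncreasingAdditive φ)
    (a : posCompact H) {f : ℝ → ℝ} (hf : IsPosVanishing (a : H →L[ℂ] H) f)
    (hmono : MonotoneOn f (spectrum ℝ (a : H →L[ℂ] H))) {c : ℝ} (hc : 0 ≤ c) :
    φ (funCalc a f hf) =
      φ (funCalc a _ (hf.posPart_sub_const hc)) + φ (funCalc a _ (hf.min_const hc)) := by
  rw [funCalc_eq_posPart_add_min a hf hc]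
  exact hφ a _ _ _ _
    (fun x hx y hy hxy => max_le_max (sub_le_sub_right (hmono hx hy hxy) c) le_rfl)
    (fun x hx y hy hxy => min_le_min (hmono hx hy hxy) le_rfl)

/-- If `c` is the least positive value of `f`, then `min f c` is a multiple of an indicator
function and `max (f - c) 0` has smaller support than `f`. -/
theorem map_funCalc_eq_of_finite_support (hφ : IsMonotoneIncreasingAdditive φ)
    (hφh : IsPosHomogeneous φ) (hψ : IsMonotoneIncreasingAdditive ψ) (hψh : IsPosHomogeneous ψ)
    (heq : ∀ (M : Submodule ℂ H) [FiniteDimensional ℂ M], φ (finiteProj M) = ψ (finiteProj M))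
    (a : posCompact H) {f : ℝ → ℝ} (hf : IsPosVanishing (a : H →L[ℂ] H) f)
    (hmono : MonotoneOn f (spectrum ℝ (a : H →L[ℂ] H)))
    (hfin : (spectrum ℝ (a : H →L[ℂ] H) ∩ {x | 0 < f x}).Finite) :
    φ (funCalc a f hf) = ψ (funCalc a f hf) := by
  set σ := spectrum ℝ (a : H →L[ℂ] H)
  induction hn : (σ ∩ {x | 0 < f x}).ncard using Nat.strong_induction_on generalizing f with
  | _ n ih =>
    rcases Set.eq_empty_or_nonempty (σ ∩ {x | 0 < f x}) with hempty | hne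
    · have hzero : funCalc a f hf = 0 := funCalc_eq_zero a hf fun x hx =>
        (not_lt.1 fun hpos => hempty.subset ⟨hx, hpos⟩).antisymm (hf.nonneg x hx)
      rw [hzero, hφh.map_zero, hψh.map_zero]
    obtain ⟨m, ⟨hm, hm0⟩, hmin⟩ := Set.exists_min_image _ f hfin hne
    lift f m to ℝ≥0 using hm0.le with c hcm
    rw [Set.mem_ofPred_eq, ← hcm, NNReal.coe_pos] at hm0
    have htwo : ∀ x ∈ σ, min (f x) c = 0 ∨ min (f x) c = c := fun x hx =>
      (hf.nonneg x hx).eq_or_lt.imp (fun h => by simp [← h])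
        fun h => min_eq_right (hmin x ⟨hx, h⟩)
    obtain ⟨M, _, hproj⟩ := exists_funCalc_eq_smul_finiteProj a (hf.min_const c.2) hm0.ne' htwo
    have hsub : σ ∩ {x | 0 < max (f x - c) 0} ⊂ σ ∩ {x | 0 < f x} := by
      have hsubset : σ ∩ {x | 0 < max (f x - c) 0} ⊆ σ ∩ {x | 0 < f x} := fun x hx => by
        have hcx : (c : ℝ) < f x := by simpa using hx.2
        exact ⟨hx.1, c.coe_nonneg.trans_lt hcx⟩
      refine (Set.ssubset_iff_of_subset hsubset).2 ⟨m, ⟨hm, ?_⟩, by simp [← hcm]⟩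
      rwa [Set.mem_ofPred_eq, ← hcm, NNReal.coe_pos]
    have hrec := ih _ (hn ▸ Set.ncard_lt_ncard hsub hfin) (hf.posPart_sub_const c.2)
      (fun x hx y hy hxy => max_le_max (sub_le_sub_right (hmono hx hy hxy) _) le_rfl)
      (hfin.subset hsub.subset) rfl
    rw [hφ.map_funCalc_eq_add a hf hmono c.2, hψ.map_funCalc_eq_add a hf hmono c.2, hrec, hproj,
      hφh, hψh, heq M]

theorem le_of_eq_on_finiteProj (hφ : IsMonotoneIncreasingAdditive φ) (hφh : IsPosHomogeneous φ)
    (hφc : LowerSemicontinuous φ) (hψ : IsMonotoneIncreasingAdditive ψ)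
    (hψh : IsPosHomogeneous ψ) (hψm : Monotone ψ)
    (heq : ∀ (M : Submodule ℂ H) [FiniteDimensional ℂ M], φ (finiteProj M) = ψ (finiteProj M)) :
    φ ≤ ψ := by
  intro a
  refine le_of_forall_lt_imp_le_of_dense fun y hy => ?_
  obtain ⟨ε, hε, hball⟩ := Metric.eventually_nhds_iff.1 (hφc a y hy)
  have hid := isPosVanishing_id a
  have ht : 0 < ε / 2 := half_pos hε
  have hcut := hid.posPart_sub_const ht.le
  have hdist : dist (funCalc a _ hcut) a < ε := by
    have := dist_funCalc_posPart_sub_le a hid ht.le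
    rw [funCalc_id] at this
    exact this.trans_lt (half_lt_self hε)
  have hle : funCalc a _ hcut ≤ a := by
    conv_rhs => rw [← funCalc_id a]
    exact funCalc_mono a hcut hid fun x hx => max_le (sub_le_self x ht.le) (hid.nonneg x hx)
  have hfin : (spectrum ℝ (a : H →L[ℂ] H) ∩ {x | 0 < max (id x - ε / 2) 0}).Finite := by
    have hset : {x : ℝ | 0 < max (id x - ε / 2) 0} = Set.Ioi (ε / 2) := by
      ext x
      simp
    rw [hset]
    exact finite_spectrum_inter_Ioi (isSymmetric_posCompact a) a.2.2 ht
  calc y ≤ φ (funCalc a _ hcut) := (hball hdist).le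
    _ = ψ (funCalc a _ hcut) := map_funCalc_eq_of_finite_support hφ hφh hψ hψh heq a hcut
        (fun x _ y _ hxy => max_le_max (sub_le_sub_right hxy _) le_rfl) hfin
    _ ≤ ψ a := hψm hle

theorem map_finiteProj_le_of_finrank_le (hφu : IsUnitarilyInvariant φ) (hφm : Monotone φ)
    {M N : Submodule ℂ H} [FiniteDimensional ℂ M] [FiniteDimensional ℂ N]
    (h : Module.finrank ℂ M ≤ Module.finrank ℂ N) : φ (finiteProj M) ≤ φ (finiteProj N) := by
  obtain ⟨K, hKN, hK⟩ := exists_submodule_le_finrank_eq h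
  have : FiniteDimensional ℂ K := Submodule.finiteDimensional_of_le hKN
  obtain ⟨u, hu⟩ := exists_unitaryConj_finiteProj_eq hK
  rw [← hu, hφu]
  exact hφm (finiteProj_mono hKN)

theorem exists_map_finiteProj_eq_coe (hφu : IsUnitarilyInvariant φ) (hφm : Monotone φ)
    (hφ0 : φ 0 = 0) (hφf : IsFiniteOnFiniteRank φ) :
    ∃ α : ℕ → ℝ≥0, Monotone α ∧ α 0 = 0 ∧ ∀ (N : Submodule ℂ H) [FiniteDimensional ℂ N],
      φ (finiteProj N) = α (Module.finrank ℂ N) := by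
  choose M hMfin hMle hMmax using exists_submodule_finrank_maximal (𝕜 := ℂ) (E := H)
  have hfinite (n : ℕ) : φ (finiteProj (M n)) ≠ ∞ :=
    (hφf _ (by rw [range_finiteProj]; exact hMfin n)).ne
  refine ⟨fun n => (φ (finiteProj (M n))).toNNReal, fun m n hmn => ?_, ?_, fun N _ => ?_⟩
  · exact ENNReal.toNNReal_mono (hfinite n) (map_finiteProj_le_of_finrank_le hφu hφm
      (hMmax n (M m) ((hMle m).trans hmn)))
  · have hle : φ (finiteProj (M 0)) ≤ φ (finiteProj ⊥) := map_finiteProj_le_of_finrank_le hφu hφm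
      (by rw [finrank_bot]; exact hMle 0)
    rw [finiteProj_bot, hφ0] at hle
    change (φ (finiteProj (M 0))).toNNReal = 0
    rw [nonpos_iff_eq_zero.1 hle, ENNReal.toNNReal_zero]
  · rw [ENNReal.coe_toNNReal (hfinite _)]
    exact (map_finiteProj_le_of_finrank_le hφu hφm (hMmax _ N le_rfl)).antisymm
      (map_finiteProj_le_of_finrank_le hφu hφm (hMle _))

theorem exists_eq_choquetTrace (hφ : IsMonotoneIncreasingAdditive φ)
    (hφu : IsUnitarilyInvariant φ) (hφm : Monotone φ) (hφh : IsPosHomogeneous φ)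
    (hφc : LowerSemicontinuous φ) (hφf : IsFiniteOnFiniteRank φ) :
    ∃ α : ℕ → ℝ≥0, Monotone α ∧ α 0 = 0 ∧ φ = choquetTrace α := by
  obtain ⟨α, hα, hα0, hφα⟩ := exists_map_finiteProj_eq_coe hφu hφm hφh.map_zero hφf
  have heq (N : Submodule ℂ H) [FiniteDimensional ℂ N] :
      φ (finiteProj N) = choquetTrace α (finiteProj N) := by
    rw [choquetTrace_finiteProj hα0, hφα]
  have hψ := (isComonotonicAdditive_choquetTrace (H := H) hα hα0).isMonotoneIncreasingAdditive
  have hψh := isPosHomogeneous_choquetTrace (H := H) α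
  refine ⟨α, hα, hα0, le_antisymm ?_ ?_⟩
  · exact le_of_eq_on_finiteProj hφ hφh hφc hψ hψh (monotone_choquetTrace hα hα0) heq
  · exact le_of_eq_on_finiteProj hψ hψh (lowerSemicontinuous_choquetTrace hα hα0) hφ hφh hφm
      fun N _ => (heq N).symm

end Uniqueness

end ChoquetTrace
end

theorem mainTheorem1_general {H : Type*} [NormedAddCommGroup H] [InnerProductSpace ℂ H]
    [CompleteSpace H] (φ : ChoquetTrace.posCompact H → ℝ≥0∞) :
    List.TFAE [
      ∃ α : ℕ → ℝ≥0, Monotone α ∧ α 0 = 0 ∧ φ = ChoquetTrace.choquetTrace α,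
      ChoquetTrace.IsMonotoneIncreasingAdditive φ ∧ ChoquetTrace.IsUnitarilyInvariant φ ∧
        Monotone φ ∧ ChoquetTrace.IsPosHomogeneous φ ∧ LowerSemicontinuous φ ∧
        ChoquetTrace.IsFiniteOnFiniteRank φ,
      ChoquetTrace.IsComonotonicAdditive φ ∧ ChoquetTrace.IsUnitarilyInvariant φ ∧
        Monotone φ ∧ ChoquetTrace.IsPosHomogeneous φ ∧ LowerSemicontinuous φ ∧
        ChoquetTrace.IsFiniteOnFiniteRank φ] := by
  tfae_have 1 → 3 := by
    rintro ⟨α, hα, hα0, rfl⟩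
    exact ⟨ChoquetTrace.isComonotonicAdditive_choquetTrace hα hα0,
      ChoquetTrace.isUnitarilyInvariant_choquetTrace α,
      ChoquetTrace.monotone_choquetTrace hα hα0,
      ChoquetTrace.isPosHomogeneous_choquetTrace α,
      ChoquetTrace.lowerSemicontinuous_choquetTrace hα hα0,
      ChoquetTrace.isFiniteOnFiniteRank_choquetTrace α⟩
  tfae_have 3 → 2 := fun h => ⟨h.1.isMonotoneIncreasingAdditive, h.2⟩
  tfae_have 2 → 1 := fun ⟨hadd, hunit, hmono, hhom, hlsc, hfin⟩ =>
    ChoquetTrace.exists_eq_choquetTrace hadd hunit hmono hhom hlsc hfin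
  tfae_finish

theorem mainTheorem1 {H : Type*} [NormedAddCommGroup H] [InnerProductSpace ℂ H] [CompleteSpace H]
    [TopologicalSpace.SeparableSpace H] (hH : ¬ FiniteDimensional ℂ H)
    (φ : ChoquetTrace.posCompact H → ℝ≥0∞) :
    List.TFAE [
      ∃ α : ℕ → ℝ≥0, Monotone α ∧ α 0 = 0 ∧ φ = ChoquetTrace.choquetTrace α,
      ChoquetTrace.IsMonotoneIncreasingAdditive φ ∧ ChoquetTrace.IsUnitarilyInvariant φ ∧ Monotone φ ∧
        ChoquetTrace.IsPosHomogeneous φ ∧ LowerSemicontinuous φ ∧ ChoquetTrace.IsFiniteOnFiniteRank φ,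
      ChoquetTrace.IsComonotonicAdditive φ ∧ ChoquetTrace.IsUnitarilyInvariant φ ∧ Monotone φ ∧
        ChoquetTrace.IsPosHomogeneous φ ∧ LowerSemicontinuous φ ∧ ChoquetTrace.IsFiniteOnFiniteRank φ] :=
  mainTheorem1_general φ
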